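/- Let $\mathcal{E}\mathsf{nd}^{\mathsf{colax}}(\mathcal{C}\mathsf{art})$ be the following (strict) 2-category. An object is a pair $(\mathsf C, F)$ of a category $\mathsf C$ with (chosen) finite products and an endofunctor $F : \mathsf C \to \mathsf C$ (not assumed to preserve products). A 1-cell $(\mathsf C,F) \to (\mathsf D,G)$ is a finite product preserving functor $A : \mathsf C \to \mathsf D$ together with a natural transformation $\alpha : A F \Rightarrow G A$. A 2-cell $(A,\alpha) \Rightarrow (B,\beta)$ is a natural transformation $\varphi : A \Rightarrow B$ with $\beta \circ \varphi F = G\varphi \circ \alpha$. This 2-category has finite 2-categorical products, namely $(\mathsf C,F)\times(\mathsf D,G) = (\mathsf C\times\mathsf D, F\times G)$ and the terminal category with its identity functor. A symmetric monoidal structure on an object $X$ of a 2-category with finite products consists of 1-cells $\otimes : X \times X \to X$ and $1 : \bullet \to X$ together with invertible associativity, unit and symmetry 2-cells satisfying the usual coherence axioms of a symmetric monoidal category. A morphism between two such structures on the same $X$ consists of invertible 2-cells $\otimes \cong \otimes'$ and $1 \cong 1'$ compatible with the associativity, unit and symmetry 2-cells. **Lemma.** Let $\mathsf C$ be a category with finite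 products and $F : \mathsf C \to \mathsf C$ an endofunctor. A symmetric monoidal structure on the object $(\mathsf C, F)$ of $\mathcal{E}\mathsf{nd}^{\mathsf{colax}}(\mathcal{C}\mathsf{art})$ is the same thing as a lax symmetric monoidal structure on $F$ with respect to the cartesian product of $\mathsf C$. Precisely, send a lax symmetric monoidal structure on $F$, with $\varepsilon : 1 \to F1$ and $\mu_{x,y} : Fx \times Fy \to F(x\times y)$, to the symmetric monoidal structure on $(\mathsf C, F)$ whose multiplication is the 1-cell $(\times, \mu)$, whose unit is the 1-cell $(1, \varepsilon)$, and whose associativity, unit and symmetry 2-cells are the canonical isomorphisms of the cartesian product. This defines an equivalence of categories from the set (discrete category) of lax symmetric monoidal structures on $F$ with respect to $\times$ to the category of symmetric monoidal structures on $(\mathsf C, F)$. In particular, for every symmetric monoidal structure on $(\mathsf C,F)$ there are a unique lax symmetric monoidal structure on $F$ and a unique isomorphism from the symmetric monoidal structure it determines. -/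

import Mathlib

open CategoryTheory

universe v u w₁ w₂ w₃

namespace TwoAlgebra

section General

open Bicategory

/-- A cartesian 2-category: a strict 2-category with chosen finite 2-categorical products.
The terminal object satisfies `K(Z, 1) ≅ 1`, and composition with the projections is an isomorphism
of categories `K(Z, X × Y) ≅ K(Z, X) × K(Z, Y)`: `lift` is its inverse on 1-cells and `lift₂` is
its inverse on 2-cells. -/
class CartesianTwoCategory (K : Type w₃) [Bicategory.{w₁, w₂} K] [Bicategory.Strict K] where
  one : K
  toOne (Z : K) : Z ⟶ one
  toOne_unique {Z : K} (f : Z ⟶ one) : f = toOne Z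
  twoOne {Z : K} (f g : Z ⟶ one) : f ⟶ g
  twoOne_unique {Z : K} {f g : Z ⟶ one} (θ : f ⟶ g) : θ = twoOne f g
  prod (X Y : K) : K
  fst (X Y : K) : prod X Y ⟶ X
  snd (X Y : K) : prod X Y ⟶ Y
  lift {Z X Y : K} (f : Z ⟶ X) (g : Z ⟶ Y) : Z ⟶ prod X Y
  lift_fst {Z X Y : K} (f : Z ⟶ X) (g : Z ⟶ Y) : lift f g ≫ fst X Y = f
  lift_snd {Z X Y : K} (f : Z ⟶ X) (g : Z ⟶ Y) : lift f g ≫ snd X Y = g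
  lift_unique {Z X Y : K} (h : Z ⟶ prod X Y) : h = lift (h ≫ fst X Y) (h ≫ snd X Y)
  lift₂ {Z X Y : K} {h k : Z ⟶ prod X Y} (θ : h ≫ fst X Y ⟶ k ≫ fst X Y)
    (ψ : h ≫ snd X Y ⟶ k ≫ snd X Y) : h ⟶ k
  lift₂_fst {Z X Y : K} {h k : Z ⟶ prod X Y} (θ : h ≫ fst X Y ⟶ k ≫ fst X Y)
    (ψ : h ≫ snd X Y ⟶ k ≫ snd X Y) : lift₂ θ ψ ▷ fst X Y = θ
  lift₂_snd {Z X Y : K} {h k : Z ⟶ prod X Y} (θ : h ≫ fst X Y ⟶ k ≫ fst X Y)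
    (ψ : h ≫ snd X Y ⟶ k ≫ snd X Y) : lift₂ θ ψ ▷ snd X Y = ψ
  lift₂_unique {Z X Y : K} {h k : Z ⟶ prod X Y} (χ : h ⟶ k) :
    χ = lift₂ (χ ▷ fst X Y) (χ ▷ snd X Y)

namespace CartesianTwoCategory

variable {K : Type w₃} [Bicategory.{w₁, w₂} K] [Bicategory.Strict K] [CartesianTwoCategory K]

theorem comp_lift {W Z X Y : K} (h : W ⟶ Z) (f : Z ⟶ X) (g : Z ⟶ Y) :
    h ≫ lift f g = lift (h ≫ f) (h ≫ g) := by
  rw [lift_unique (h ≫ lift f g), Strict.assoc, Strict.assoc, lift_fst, lift_snd]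

theorem comp_toOne {W Z : K} (h : W ⟶ Z) : h ≫ toOne Z = toOne W := toOne_unique _

theorem hom₂_ext {Z X Y : K} {h k : Z ⟶ prod X Y} {χ χ' : h ⟶ k}
    (h₁ : χ ▷ fst X Y = χ' ▷ fst X Y) (h₂ : χ ▷ snd X Y = χ' ▷ snd X Y) : χ = χ' := by
  rw [lift₂_unique χ, lift₂_unique χ', h₁, h₂]

/-- The pairing `⟨θ, ψ⟩ : ⟨f, g⟩ ⟶ ⟨f', g'⟩` of two 2-cells. -/
def pair₂ {Z X Y : K} {f f' : Z ⟶ X} {g g' : Z ⟶ Y} (θ : f ⟶ f') (ψ : g ⟶ g') :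
    lift f g ⟶ lift f' g' :=
  lift₂ (eqToHom (lift_fst f g) ≫ θ ≫ eqToHom (lift_fst f' g').symm)
    (eqToHom (lift_snd f g) ≫ ψ ≫ eqToHom (lift_snd f' g').symm)

theorem pair₂_id {Z X Y : K} (f : Z ⟶ X) (g : Z ⟶ Y) : pair₂ (𝟙 f) (𝟙 g) = 𝟙 (lift f g) := by
  apply hom₂_ext <;> simp [pair₂, lift₂_fst, lift₂_snd]

theorem pair₂_comp {Z X Y : K} {f f' f'' : Z ⟶ X} {g g' g'' : Z ⟶ Y} (θ : f ⟶ f') (θ' : f' ⟶ f'')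
    (ψ : g ⟶ g') (ψ' : g' ⟶ g'') : pair₂ (θ ≫ θ') (ψ ≫ ψ') = pair₂ θ ψ ≫ pair₂ θ' ψ' := by
  apply hom₂_ext <;> simp [pair₂, lift₂_fst, lift₂_snd]

end CartesianTwoCategory

open CartesianTwoCategory

variable {K : Type w₃} [Bicategory.{w₁, w₂} K] [Bicategory.Strict K] [CartesianTwoCategory K]

/-- A multiplication `X × X ⟶ X` and a unit `1 ⟶ X` on an object `X` of a cartesian 2-category. -/
structure MagmaObject (X : K) where
  mul : prod X X ⟶ X
  unit : one ⟶ X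

namespace MagmaObject

variable {X : K} (M : MagmaObject X)

/-- The product `x ⊗ y = mul ∘ ⟨x, y⟩` of two generalized elements. -/
def tensor {Z : K} (x y : Z ⟶ X) : Z ⟶ X := lift x y ≫ M.mul

/-- The product of two 2-cells between generalized elements. -/
def tensor₂ {Z : K} {x x' y y' : Z ⟶ X} (θ : x ⟶ x') (ψ : y ⟶ y') : M.tensor x y ⟶ M.tensor x' y' :=
  pair₂ θ ψ ▷ M.mul

/-- The unit as a generalized element `Z ⟶ 1 ⟶ X`. -/
def unitAt (Z : K) : Z ⟶ X := toOne Z ≫ M.unit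

theorem comp_tensor {W Z : K} (h : W ⟶ Z) (x y : Z ⟶ X) :
    h ≫ M.tensor x y = M.tensor (h ≫ x) (h ≫ y) := by
  rw [tensor, tensor, ← comp_lift, Strict.assoc]

theorem comp_unitAt {W Z : K} (h : W ⟶ Z) : h ≫ M.unitAt Z = M.unitAt W := by
  rw [unitAt, unitAt, ← comp_toOne h, Strict.assoc]

theorem tensor₂_id {Z : K} (x y : Z ⟶ X) : M.tensor₂ (𝟙 x) (𝟙 y) = 𝟙 (M.tensor x y) := by
  simp [tensor₂, pair₂_id, tensor]

theorem tensor₂_comp {Z : K} {x x' x'' y y' y'' : Z ⟶ X} (θ : x ⟶ x') (θ' : x' ⟶ x'')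
    (ψ : y ⟶ y') (ψ' : y' ⟶ y'') :
    M.tensor₂ (θ ≫ θ') (ψ ≫ ψ') = M.tensor₂ θ ψ ≫ M.tensor₂ θ' ψ' := by
  rw [tensor₂, tensor₂, tensor₂, pair₂_comp, comp_whiskerRight]; rfl

theorem tensor₂_comp_left {Z : K} {x x' x'' : Z ⟶ X} (θ : x ⟶ x') (θ' : x' ⟶ x'') (y : Z ⟶ X) :
    M.tensor₂ (θ ≫ θ') (𝟙 y) = M.tensor₂ θ (𝟙 y) ≫ M.tensor₂ θ' (𝟙 y) := by
  rw [← tensor₂_comp, Category.comp_id]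

theorem tensor₂_comp_right {Z : K} {y y' y'' : Z ⟶ X} (x : Z ⟶ X) (ψ : y ⟶ y') (ψ' : y' ⟶ y'') :
    M.tensor₂ (𝟙 x) (ψ ≫ ψ') = M.tensor₂ (𝟙 x) ψ ≫ M.tensor₂ (𝟙 x) ψ' := by
  rw [← tensor₂_comp, Category.comp_id]

variable {M} {N P : MagmaObject X}

/-- The component `x ⊗ y ⟶ x ⊗' y` of a 2-cell between two multiplications. -/
def mulAt (θ : M.mul ⟶ N.mul) {Z : K} (x y : Z ⟶ X) : M.tensor x y ⟶ N.tensor x y :=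
  lift x y ◁ θ

/-- The component of a 2-cell between two units. -/
def unitComp (η : M.unit ⟶ N.unit) (Z : K) : M.unitAt Z ⟶ N.unitAt Z := toOne Z ◁ η

theorem mulAt_id {Z : K} (x y : Z ⟶ X) : mulAt (𝟙 M.mul) x y = 𝟙 (M.tensor x y) :=
  whiskerLeft_id _ _

theorem mulAt_comp (θ : M.mul ⟶ N.mul) (θ' : N.mul ⟶ P.mul) {Z : K} (x y : Z ⟶ X) :
    mulAt (M := M) (N := P) (θ ≫ θ') x y = mulAt θ x y ≫ mulAt θ' x y :=
  whiskerLeft_comp _ _ _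

theorem unitComp_id (Z : K) : unitComp (𝟙 M.unit) Z = 𝟙 (M.unitAt Z) := whiskerLeft_id _ _

theorem unitComp_comp (η : M.unit ⟶ N.unit) (η' : N.unit ⟶ P.unit) (Z : K) :
    unitComp (M := M) (N := P) (η ≫ η') Z = unitComp η Z ≫ unitComp η' Z :=
  whiskerLeft_comp _ _ _

theorem mulAt_naturality (θ : M.mul ⟶ N.mul) {Z : K} {x x' y y' : Z ⟶ X} (a : x ⟶ x')
    (b : y ⟶ y') : M.tensor₂ a b ≫ mulAt θ x' y' = mulAt θ x y ≫ N.tensor₂ a b :=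
  (whisker_exchange (pair₂ a b) θ).symm

theorem mulAt_naturality_assoc (θ : M.mul ⟶ N.mul) {Z : K} {x x' y y' : Z ⟶ X} (a : x ⟶ x')
    (b : y ⟶ y') {w : Z ⟶ X} (χ : N.tensor x' y' ⟶ w) :
    M.tensor₂ a b ≫ mulAt θ x' y' ≫ χ = mulAt θ x y ≫ N.tensor₂ a b ≫ χ := by
  rw [← Category.assoc, mulAt_naturality, Category.assoc]

end MagmaObject

/-- The first projection `(X × X) × X ⟶ X`. -/
abbrev pr₁ (X : K) : prod (prod X X) X ⟶ X := fst (prod X X) X ≫ fst X X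
/-- The second projection `(X × X) × X ⟶ X`. -/
abbrev pr₂ (X : K) : prod (prod X X) X ⟶ X := fst (prod X X) X ≫ snd X X
/-- The third projection `(X × X) × X ⟶ X`. -/
abbrev pr₃ (X : K) : prod (prod X X) X ⟶ X := snd (prod X X) X

/-- A multiplication and a unit with invertible associativity, unit and symmetry 2-cells
(not yet subject to any axiom). -/
structure SymmetricMonoidalData (X : K) extends MagmaObject X where
  assoc : toMagmaObject.tensor (toMagmaObject.tensor (pr₁ X) (pr₂ X)) (pr₃ X) ≅
    toMagmaObject.tensor (pr₁ X) (toMagmaObject.tensor (pr₂ X) (pr₃ X))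
  leftUnit : toMagmaObject.tensor (toMagmaObject.unitAt X) (𝟙 X) ≅ 𝟙 X
  rightUnit : toMagmaObject.tensor (𝟙 X) (toMagmaObject.unitAt X) ≅ 𝟙 X
  symm : toMagmaObject.tensor (fst X X) (snd X X) ≅ toMagmaObject.tensor (snd X X) (fst X X)

namespace SymmetricMonoidalData

variable {X : K} (M : SymmetricMonoidalData X) {Z : K}

theorem triple_comp_left (x y z : Z ⟶ X) :
    lift (lift x y) z ≫ M.tensor (M.tensor (pr₁ X) (pr₂ X)) (pr₃ X) = M.tensor (M.tensor x y) z := by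
  simp only [MagmaObject.comp_tensor, ← Strict.assoc, lift_fst, lift_snd]

theorem triple_comp_right (x y z : Z ⟶ X) :
    lift (lift x y) z ≫ M.tensor (pr₁ X) (M.tensor (pr₂ X) (pr₃ X)) = M.tensor x (M.tensor y z) := by
  simp only [MagmaObject.comp_tensor, ← Strict.assoc, lift_fst, lift_snd]

theorem comp_leftUnit (x : Z ⟶ X) :
    x ≫ M.tensor (M.unitAt X) (𝟙 X) = M.tensor (M.unitAt Z) x := by
  rw [MagmaObject.comp_tensor, MagmaObject.comp_unitAt, Strict.comp_id]

theorem comp_rightUnit (x : Z ⟶ X) :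
    x ≫ M.tensor (𝟙 X) (M.unitAt X) = M.tensor x (M.unitAt Z) := by
  rw [MagmaObject.comp_tensor, MagmaObject.comp_unitAt, Strict.comp_id]

theorem pair_comp (x y : Z ⟶ X) : lift x y ≫ M.tensor (fst X X) (snd X X) = M.tensor x y := by
  rw [MagmaObject.comp_tensor, lift_fst, lift_snd]

theorem pair_comp_swap (x y : Z ⟶ X) :
    lift x y ≫ M.tensor (snd X X) (fst X X) = M.tensor y x := by
  rw [MagmaObject.comp_tensor, lift_fst, lift_snd]

/-- The component `(x ⊗ y) ⊗ z ⟶ x ⊗ (y ⊗ z)` of the associator at generalized elements,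
i.e. its whiskering with `⟨x, y, z⟩`. -/
def assocAt (x y z : Z ⟶ X) : M.tensor (M.tensor x y) z ⟶ M.tensor x (M.tensor y z) :=
  eqToHom (M.triple_comp_left x y z).symm ≫ lift (lift x y) z ◁ M.assoc.hom ≫
    eqToHom (M.triple_comp_right x y z)

/-- The component `e ⊗ x ⟶ x` of the left unit 2-cell. -/
def leftUnitAt (x : Z ⟶ X) : M.tensor (M.unitAt Z) x ⟶ x :=
  eqToHom (M.comp_leftUnit x).symm ≫ x ◁ M.leftUnit.hom ≫ eqToHom (Strict.comp_id x)

/-- The component `x ⊗ e ⟶ x` of the right unit 2-cell. -/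
def rightUnitAt (x : Z ⟶ X) : M.tensor x (M.unitAt Z) ⟶ x :=
  eqToHom (M.comp_rightUnit x).symm ≫ x ◁ M.rightUnit.hom ≫ eqToHom (Strict.comp_id x)

/-- The component `x ⊗ y ⟶ y ⊗ x` of the symmetry 2-cell. -/
def symmAt (x y : Z ⟶ X) : M.tensor x y ⟶ M.tensor y x :=
  eqToHom (M.pair_comp x y).symm ≫ lift x y ◁ M.symm.hom ≫ eqToHom (M.pair_comp_swap x y)

end SymmetricMonoidalData

/-- The coherence axioms of a symmetric monoidal object. They are equations of 2-cells between
1-cells `X × ⋯ × X ⟶ X`; by the universal property of the products they are written at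
generalized elements `Z ⟶ X`. (One hexagon suffices, because the braiding is a symmetry.) -/
structure SymmetricMonoidalData.Coherent {X : K} (M : SymmetricMonoidalData X) : Prop where
  pentagon {Z : K} (w x y z : Z ⟶ X) :
    M.tensor₂ (M.assocAt w x y) (𝟙 z) ≫ M.assocAt w (M.tensor x y) z ≫
        M.tensor₂ (𝟙 w) (M.assocAt x y z) =
      M.assocAt (M.tensor w x) y z ≫ M.assocAt w x (M.tensor y z)
  triangle {Z : K} (x y : Z ⟶ X) :
    M.assocAt x (M.unitAt Z) y ≫ M.tensor₂ (𝟙 x) (M.leftUnitAt y) =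
      M.tensor₂ (M.rightUnitAt x) (𝟙 y)
  hexagon {Z : K} (x y z : Z ⟶ X) :
    M.assocAt x y z ≫ M.symmAt x (M.tensor y z) ≫ M.assocAt y z x =
      M.tensor₂ (M.symmAt x y) (𝟙 z) ≫ M.assocAt y x z ≫ M.tensor₂ (𝟙 y) (M.symmAt x z)
  symmetry {Z : K} (x y : Z ⟶ X) : M.symmAt x y ≫ M.symmAt y x = 𝟙 (M.tensor x y)

/-- A symmetric monoidal structure on an object `X` of a cartesian 2-category. An object `X` with
such a structure is a symmetric monoidal object (symmetric pseudomonoid). -/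
structure SymmetricMonoidalStructure (X : K) extends SymmetricMonoidalData X where
  coherent : toSymmetricMonoidalData.Coherent

namespace SymmetricMonoidalStructure

open MagmaObject

variable {X : K}

/-- A morphism between symmetric monoidal structures on the same object: a (pseudo) symmetric
monoidal morphism whose underlying 1-cell is the identity. It consists of invertible 2-cells
between the multiplications and between the units, compatible with associativity, units and
symmetry. -/
@[ext]
structure Hom (S T : SymmetricMonoidalStructure X) where
  mulIso : S.mul ≅ T.mul
  unitIso : S.unit ≅ T.unit
  assoc_comp {Z : K} (x y z : Z ⟶ X) :
    mulAt mulIso.hom (S.tensor x y) z ≫ T.tensor₂ (mulAt mulIso.hom x y) (𝟙 z) ≫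
        T.assocAt x y z =
      S.assocAt x y z ≫ mulAt mulIso.hom x (S.tensor y z) ≫
        T.tensor₂ (𝟙 x) (mulAt mulIso.hom y z)
  leftUnit_comp {Z : K} (x : Z ⟶ X) :
    mulAt mulIso.hom (S.unitAt Z) x ≫ T.tensor₂ (unitComp unitIso.hom Z) (𝟙 x) ≫ T.leftUnitAt x =
      S.leftUnitAt x
  rightUnit_comp {Z : K} (x : Z ⟶ X) :
    mulAt mulIso.hom x (S.unitAt Z) ≫ T.tensor₂ (𝟙 x) (unitComp unitIso.hom Z) ≫
      T.rightUnitAt x = S.rightUnitAt x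
  symm_comp {Z : K} (x y : Z ⟶ X) :
    mulAt mulIso.hom x y ≫ T.symmAt x y = S.symmAt x y ≫ mulAt mulIso.hom y x

/-- The identity morphism. -/
def Hom.id (S : SymmetricMonoidalStructure X) : Hom S S where
  mulIso := Iso.refl _
  unitIso := Iso.refl _
  assoc_comp x y z := by simp [mulAt_id, tensor₂_id]
  leftUnit_comp x := by simp [mulAt_id, unitComp_id, tensor₂_id]
  rightUnit_comp x := by simp [mulAt_id, unitComp_id, tensor₂_id]
  symm_comp x y := by simp [mulAt_id]

/-- The composition of morphisms. -/
def Hom.comp {S T U : SymmetricMonoidalStructure X} (f : Hom S T) (g : Hom T U) : Hom S U where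
  mulIso := f.mulIso ≪≫ g.mulIso
  unitIso := f.unitIso ≪≫ g.unitIso
  assoc_comp x y z := by
    simp only [Iso.trans_hom, mulAt_comp, tensor₂_comp_left, tensor₂_comp_right, Category.assoc]
    rw [← mulAt_naturality_assoc g.mulIso.hom (mulAt f.mulIso.hom x y), g.assoc_comp,
      ← mulAt_naturality_assoc g.mulIso.hom (𝟙 x) (mulAt f.mulIso.hom y z),
      reassoc_of% (f.assoc_comp x y z)]
  leftUnit_comp x := by
    simp only [Iso.trans_hom, mulAt_comp, unitComp_comp, tensor₂_comp_left, Category.assoc]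
    rw [← mulAt_naturality_assoc, g.leftUnit_comp, f.leftUnit_comp]
  rightUnit_comp x := by
    simp only [Iso.trans_hom, mulAt_comp, unitComp_comp, tensor₂_comp_right, Category.assoc]
    rw [← mulAt_naturality_assoc, g.rightUnit_comp, f.rightUnit_comp]
  symm_comp x y := by
    simp only [Iso.trans_hom, mulAt_comp, Category.assoc]
    rw [g.symm_comp, reassoc_of% (f.symm_comp x y)]

instance : Category (SymmetricMonoidalStructure X) where
  Hom := Hom
  id := Hom.id
  comp := Hom.comp
  id_comp f := by apply Hom.ext <;> simp [Hom.id, Hom.comp]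
  comp_id f := by apply Hom.ext <;> simp [Hom.id, Hom.comp]
  assoc f g h := by apply Hom.ext <;> simp [Hom.comp]

end SymmetricMonoidalStructure

end General

section Endofunctors

open Limits MonoidalCategory CartesianMonoidalCategory

/-- An object of the 2-category: a cartesian category (a category with chosen finite products)
with an arbitrary endofunctor `F`, which need not preserve finite products. -/
structure CartEndo : Type (max (u + 1) (v + 1)) where
  C : Type u
  [category : Category.{v} C]
  [cartesian : CartesianMonoidalCategory C]
  F : C ⥤ C

attribute [instance] CartEndo.category CartEndo.cartesian

namespace CartEndo

/-- A 1-cell: a cartesian (finite product preserving) functor `A` with a colax square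
`A F ⟹ G A`. -/
@[ext]
structure OneCell (X Y : CartEndo.{v, u}) where
  functor : X.C ⥤ Y.C
  preserves : PreservesFiniteProducts functor
  square : X.F ⋙ functor ⟶ functor ⋙ Y.F

/-- A 2-cell: a natural transformation compatible with the colax squares. -/
@[ext]
structure TwoCell {X Y : CartEndo.{v, u}} (A B : OneCell X Y) where
  nat : A.functor ⟶ B.functor
  comm (c : X.C) : nat.app (X.F.obj c) ≫ B.square.app c = A.square.app c ≫ Y.F.map (nat.app c)

instance (X Y : CartEndo.{v, u}) : Category (OneCell X Y) where
  Hom A B := TwoCell A B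
  id A := ⟨𝟙 _, fun c => by simp⟩
  comp φ ψ := ⟨φ.nat ≫ ψ.nat, fun c => by
    have h := φ.comm c
    simp [ψ.comm, reassoc_of% h]⟩

instance : CategoryStruct CartEndo.{v, u} where
  Hom X Y := OneCell X Y
  id X := ⟨𝟭 _, inferInstance, 𝟙 X.F⟩
  comp {X Y Z} A B :=
    { functor := A.functor ⋙ B.functor
      preserves := by
        have := A.preserves
        have := B.preserves
        exact inferInstance
      square :=
        { app c := B.functor.map (A.square.app c) ≫ B.square.app (A.functor.obj c)
          naturality c d f := by
            have h₁ := congrArg B.functor.map (A.square.naturality f)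
            have h₂ := B.square.naturality (A.functor.map f)
            dsimp at h₁ h₂ ⊢
            rw [Category.assoc, ← h₂, ← B.functor.map_comp_assoc, h₁,
              B.functor.map_comp_assoc] } }

variable {X Y Z W : CartEndo.{v, u}}

instance (X Y : CartEndo.{v, u}) : Category (X ⟶ Y) := inferInstanceAs (Category (OneCell X Y))

@[simp] theorem id_functor : OneCell.functor (𝟙 X) = 𝟭 X.C := rfl
@[simp] theorem id_square (c : X.C) : (OneCell.square (𝟙 X)).app c = 𝟙 (X.F.obj c) := rfl
@[simp] theorem comp_functor (A : X ⟶ Y) (B : Y ⟶ Z) :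
    OneCell.functor (A ≫ B) = OneCell.functor A ⋙ OneCell.functor B := rfl
@[simp] theorem comp_square (A : X ⟶ Y) (B : Y ⟶ Z) (c : X.C) :
    (OneCell.square (A ≫ B)).app c = (OneCell.functor B).map ((OneCell.square A).app c) ≫
      (OneCell.square B).app ((OneCell.functor A).obj c) := rfl
@[simp] theorem id_nat (A : X ⟶ Y) : TwoCell.nat (𝟙 A) = 𝟙 (OneCell.functor A) := rfl
@[simp] theorem comp_nat {A B D : X ⟶ Y} (φ : A ⟶ B) (ψ : B ⟶ D) :
    TwoCell.nat (φ ≫ ψ) = TwoCell.nat φ ≫ TwoCell.nat ψ := rfl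

@[ext]
theorem twoCell_ext {A B : X ⟶ Y} {φ ψ : A ⟶ B}
    (h : ∀ c, (TwoCell.nat φ).app c = (TwoCell.nat ψ).app c) : φ = ψ :=
  TwoCell.ext (NatTrans.ext (funext h))

/-- 1-cells with definitionally equal functors agree when their squares agree. -/
theorem oneCell_ext {A B : X ⟶ Y} (h : OneCell.functor A = OneCell.functor B)
    (h' : ∀ c, (OneCell.square A).app c ≫ eqToHom (by rw [h]) =
      eqToHom (by rw [h]) ≫ (OneCell.square B).app c) : A = B := by
  obtain ⟨A, pA, α⟩ := A
  obtain ⟨B, pB, β⟩ := B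
  obtain rfl : A = B := h
  obtain rfl : α = β := by
    ext c
    simpa using h' c
  rfl

/-- Invertible 2-cells from invertible natural transformations. -/
def isoMk {A B : X ⟶ Y} (e : OneCell.functor A ≅ OneCell.functor B)
    (comm : ∀ c, e.hom.app (X.F.obj c) ≫ (OneCell.square B).app c =
      (OneCell.square A).app c ≫ Y.F.map (e.hom.app c)) : A ≅ B where
  hom := (⟨e.hom, comm⟩ : TwoCell A B)
  inv := (⟨e.inv, fun c => by
    rw [← cancel_epi (e.hom.app (X.F.obj c)), ← Category.assoc, e.hom_inv_id_app,
      reassoc_of% (comm c), ← Functor.map_comp, e.hom_inv_id_app]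
    simp⟩ : TwoCell B A)
  hom_inv_id := by ext c; simp
  inv_hom_id := by ext c; simp

@[simp] theorem isoMk_hom_nat {A B : X ⟶ Y} (e : OneCell.functor A ≅ OneCell.functor B) (comm) :
    TwoCell.nat (isoMk (A := A) (B := B) e comm).hom = e.hom := rfl
@[simp] theorem isoMk_inv_nat {A B : X ⟶ Y} (e : OneCell.functor A ≅ OneCell.functor B) (comm) :
    TwoCell.nat (isoMk (A := A) (B := B) e comm).inv = e.inv := rfl

/-- Whiskering of a 2-cell by a 1-cell on the left. -/
def whiskerL (A : X ⟶ Y) {B D : Y ⟶ Z} (φ : B ⟶ D) : A ≫ B ⟶ A ≫ D :=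
  (⟨Functor.whiskerLeft (OneCell.functor A) (TwoCell.nat φ), fun c => by
    have h₁ := (TwoCell.nat φ).naturality ((OneCell.square A).app c)
    have h₂ := TwoCell.comm φ ((OneCell.functor A).obj c)
    dsimp at h₁ h₂ ⊢
    rw [← reassoc_of% h₁, h₂, Category.assoc]⟩ : TwoCell (A ≫ B) (A ≫ D))

/-- Whiskering of a 2-cell by a 1-cell on the right. -/
def whiskerR {A B : X ⟶ Y} (φ : A ⟶ B) (D : Y ⟶ Z) : A ≫ D ⟶ B ≫ D :=
  (⟨Functor.whiskerRight (TwoCell.nat φ) (OneCell.functor D), fun c => by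
    have h₁ := congrArg (OneCell.functor D).map (TwoCell.comm φ c)
    have h₂ := (OneCell.square D).naturality ((TwoCell.nat φ).app c)
    simp only [Functor.map_comp] at h₁
    dsimp at h₂ ⊢
    rw [reassoc_of% h₁, h₂, Category.assoc]⟩ : TwoCell (A ≫ D) (B ≫ D))

@[simp] theorem whiskerL_app (A : X ⟶ Y) {B D : Y ⟶ Z} (φ : B ⟶ D) (c : X.C) :
    (TwoCell.nat (whiskerL A φ)).app c = (TwoCell.nat φ).app ((OneCell.functor A).obj c) := rfl
@[simp] theorem whiskerR_app {A B : X ⟶ Y} (φ : A ⟶ B) (D : Y ⟶ Z) (c : X.C) :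
    (TwoCell.nat (whiskerR φ D)).app c = (OneCell.functor D).map ((TwoCell.nat φ).app c) := rfl

/-- The associator, an identity. -/
def associatorIso (A : X ⟶ Y) (B : Y ⟶ Z) (D : Z ⟶ W) : (A ≫ B) ≫ D ≅ A ≫ B ≫ D :=
  isoMk (A := (A ≫ B) ≫ D) (B := A ≫ B ≫ D) (Functor.associator _ _ _) (fun c => by simp)

/-- The left unitor, an identity. -/
def leftUnitorIso (A : X ⟶ Y) : 𝟙 X ≫ A ≅ A :=
  isoMk (A := 𝟙 X ≫ A) (B := A) (Functor.leftUnitor _) (fun c => by simp)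

/-- The right unitor, an identity. -/
def rightUnitorIso (A : X ⟶ Y) : A ≫ 𝟙 Y ≅ A :=
  isoMk (A := A ≫ 𝟙 Y) (B := A) (Functor.rightUnitor _) (fun c => by simp)

@[simp] theorem associatorIso_hom_app (A : X ⟶ Y) (B : Y ⟶ Z) (D : Z ⟶ W) (c : X.C) :
    (TwoCell.nat (associatorIso A B D).hom).app c =
      𝟙 ((OneCell.functor D).obj ((OneCell.functor B).obj ((OneCell.functor A).obj c))) := rfl
@[simp] theorem associatorIso_inv_app (A : X ⟶ Y) (B : Y ⟶ Z) (D : Z ⟶ W) (c : X.C) :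
    (TwoCell.nat (associatorIso A B D).inv).app c =
      𝟙 ((OneCell.functor D).obj ((OneCell.functor B).obj ((OneCell.functor A).obj c))) := rfl
@[simp] theorem leftUnitorIso_hom_app (A : X ⟶ Y) (c : X.C) :
    (TwoCell.nat (leftUnitorIso A).hom).app c = 𝟙 ((OneCell.functor A).obj c) := rfl
@[simp] theorem leftUnitorIso_inv_app (A : X ⟶ Y) (c : X.C) :
    (TwoCell.nat (leftUnitorIso A).inv).app c = 𝟙 ((OneCell.functor A).obj c) := rfl
@[simp] theorem rightUnitorIso_hom_app (A : X ⟶ Y) (c : X.C) :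
    (TwoCell.nat (rightUnitorIso A).hom).app c = 𝟙 ((OneCell.functor A).obj c) := rfl
@[simp] theorem rightUnitorIso_inv_app (A : X ⟶ Y) (c : X.C) :
    (TwoCell.nat (rightUnitorIso A).inv).app c = 𝟙 ((OneCell.functor A).obj c) := rfl

/-- The 2-category of endofunctors on cartesian categories, with colax squares. -/
instance : Bicategory CartEndo.{v, u} where
  whiskerLeft := whiskerL
  whiskerRight := whiskerR
  associator := associatorIso
  leftUnitor := leftUnitorIso
  rightUnitor := rightUnitorIso

open Bicategory

@[simp] theorem whiskerLeft_app (A : X ⟶ Y) {B D : Y ⟶ Z} (φ : B ⟶ D) (c : X.C) :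
    (TwoCell.nat (A ◁ φ)).app c = (TwoCell.nat φ).app ((OneCell.functor A).obj c) := rfl
@[simp] theorem whiskerRight_app {A B : X ⟶ Y} (φ : A ⟶ B) (D : Y ⟶ Z) (c : X.C) :
    (TwoCell.nat (φ ▷ D)).app c = (OneCell.functor D).map ((TwoCell.nat φ).app c) := rfl

theorem eqToHom_nat {A B : X ⟶ Y} (h : A = B) (c : X.C) :
    (TwoCell.nat (eqToHom h)).app c = eqToHom (by rw [h]) := by
  subst h
  rfl

instance : Bicategory.Strict CartEndo.{v, u} where
  id_comp A := oneCell_ext rfl (fun c => by simp)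
  comp_id A := oneCell_ext rfl (fun c => by simp)
  assoc A B D := oneCell_ext (A := (A ≫ B) ≫ D) (B := A ≫ B ≫ D) rfl (fun c => by simp)
  leftUnitor_eqToIso A := by
    apply Iso.ext
    rw [eqToIso.hom]
    ext c
    rw [eqToHom_nat]
    rfl
  rightUnitor_eqToIso A := by
    apply Iso.ext
    rw [eqToIso.hom]
    ext c
    rw [eqToHom_nat]
    rfl
  associator_eqToIso A B D := by
    apply Iso.ext
    rw [eqToIso.hom]
    ext c
    rw [eqToHom_nat]
    rfl

/-! ### Finite 2-products -/

/-- The underlying type of the terminal category. -/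
inductive Pt : Type u
  | pt

instance : Category.{v} Pt.{u} where
  Hom _ _ := PUnit.{v + 1}
  id _ := PUnit.unit
  comp _ _ := PUnit.unit

instance : CartesianMonoidalCategory Pt.{u} where
  tensorObj _ _ := Pt.pt
  tensorUnit := Pt.pt
  whiskerLeft _ _ _ _ := PUnit.unit
  whiskerRight _ _ := PUnit.unit
  associator _ _ _ := ⟨PUnit.unit, PUnit.unit, rfl, rfl⟩
  leftUnitor _ := ⟨PUnit.unit, PUnit.unit, rfl, rfl⟩
  rightUnitor _ := ⟨PUnit.unit, PUnit.unit, rfl, rfl⟩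
  isTerminalTensorUnit := IsTerminal.ofUniqueHom (fun _ => PUnit.unit) (fun _ _ => rfl)
  fst _ _ := PUnit.unit
  snd _ _ := PUnit.unit
  tensorProductIsBinaryProduct _ _ := BinaryFan.IsLimit.mk _ (fun _ _ => PUnit.unit)
    (fun _ _ => rfl) (fun _ _ => rfl) (fun _ _ _ _ _ => rfl)

section Products

variable {C D E : Type u} [Category.{v} C] [Category.{v} D] [Category.{v} E]

/-- Finite products in a product of categories are computed componentwise. -/
instance [CartesianMonoidalCategory C] [CartesianMonoidalCategory D] :
    CartesianMonoidalCategory (C × D) where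
  isTerminalTensorUnit := IsTerminal.ofUniqueHom (fun X => (toUnit X.1, toUnit X.2))
    (fun _ _ => Prod.ext (toUnit_unique _ _) (toUnit_unique _ _))
  fst X Y := (fst X.1 Y.1, fst X.2 Y.2)
  snd X Y := (snd X.1 Y.1, snd X.2 Y.2)
  fst_def X Y := Prod.ext (fst_def _ _) (fst_def _ _)
  snd_def X Y := Prod.ext (snd_def _ _) (snd_def _ _)
  tensorProductIsBinaryProduct X Y := BinaryFan.IsLimit.mk _
    (fun f g => (lift f.1 g.1, lift f.2 g.2))
    (fun f g => Prod.ext (lift_fst _ _) (lift_fst _ _))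
    (fun f g => Prod.ext (lift_snd _ _) (lift_snd _ _))
    (fun f g m hf hg => by
      subst hf hg
      apply Prod.ext <;> apply CartesianMonoidalCategory.hom_ext <;> simp)

theorem preservesFiniteProducts_fst : PreservesFiniteProducts (CategoryTheory.Prod.fst C D) where
  preserves n := ⟨fun {K} => ⟨fun {c} hc => ⟨{
    lift s := (hc.lift ⟨(s.pt, c.pt.2), Discrete.natTrans fun j => (s.π.app j, (c.π.app j).2)⟩).1
    fac s j := congrArg _root_.Prod.fst (hc.fac _ j)
    uniq s m hm := congrArg _root_.Prod.fst (hc.uniq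
      ⟨(s.pt, c.pt.2), Discrete.natTrans fun j => (s.π.app j, (c.π.app j).2)⟩ (m, 𝟙 _)
      (fun j => Prod.ext (hm j) (Category.id_comp _))) }⟩⟩⟩

theorem preservesFiniteProducts_snd : PreservesFiniteProducts (CategoryTheory.Prod.snd C D) where
  preserves n := ⟨fun {K} => ⟨fun {c} hc => ⟨{
    lift s := (hc.lift ⟨(c.pt.1, s.pt), Discrete.natTrans fun j => ((c.π.app j).1, s.π.app j)⟩).2
    fac s j := congrArg _root_.Prod.snd (hc.fac _ j)
    uniq s m hm := congrArg _root_.Prod.snd (hc.uniq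
      ⟨(c.pt.1, s.pt), Discrete.natTrans fun j => ((c.π.app j).1, s.π.app j)⟩ (𝟙 _, m)
      (fun j => Prod.ext (Category.id_comp _) (hm j))) }⟩⟩⟩

theorem preservesFiniteProducts_prod' (A : E ⥤ C) (B : E ⥤ D) (hA : PreservesFiniteProducts A)
    (hB : PreservesFiniteProducts B) : PreservesFiniteProducts (A.prod' B) where
  preserves n := ⟨fun {K} => ⟨fun {c} hc => ⟨{
    lift s := ((isLimitOfPreserves A hc).lift ((CategoryTheory.Prod.fst C D).mapCone s),
      (isLimitOfPreserves B hc).lift ((CategoryTheory.Prod.snd C D).mapCone s))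
    fac s j := Prod.ext ((isLimitOfPreserves A hc).fac ((CategoryTheory.Prod.fst C D).mapCone s) j)
      ((isLimitOfPreserves B hc).fac ((CategoryTheory.Prod.snd C D).mapCone s) j)
    uniq s m hm := Prod.ext
      ((isLimitOfPreserves A hc).uniq ((CategoryTheory.Prod.fst C D).mapCone s) m.1
        (fun j => congrArg _root_.Prod.fst (hm j)))
      ((isLimitOfPreserves B hc).uniq ((CategoryTheory.Prod.snd C D).mapCone s) m.2
        (fun j => congrArg _root_.Prod.snd (hm j))) }⟩⟩⟩

theorem preservesFiniteProducts_toPt (A : C ⥤ Pt.{u}) : PreservesFiniteProducts A where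
  preserves _ := ⟨⟨fun _ => ⟨{
    lift _ := PUnit.unit
    fac _ _ := rfl
    uniq _ _ _ := rfl }⟩⟩⟩

/-- The constant functor at the terminal object is cartesian. -/
theorem preservesFiniteProducts_unit [CartesianMonoidalCategory C] :
    PreservesFiniteProducts ((Functor.const Pt.{u}).obj (𝟙_ C)) where
  preserves _ := ⟨⟨fun _ => ⟨{
    lift s := toUnit s.pt
    fac _ _ := toUnit_unique _ _
    uniq _ _ _ := toUnit_unique _ _ }⟩⟩⟩

/-- The product functor is cartesian. -/
theorem preservesFiniteProducts_tensor [CartesianMonoidalCategory C] :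
    PreservesFiniteProducts (tensor C) where
  preserves n := ⟨fun {K} => ⟨fun {c} hc => by
    have := preservesFiniteProducts_fst (C := C) (D := C)
    have := preservesFiniteProducts_snd (C := C) (D := C)
    let h₁ := isLimitOfPreserves (CategoryTheory.Prod.fst C C) hc
    let h₂ := isLimitOfPreserves (CategoryTheory.Prod.snd C C) hc
    let s₁ (s : Cone (K ⋙ tensor C)) : Cone (K ⋙ CategoryTheory.Prod.fst C C) :=
      ⟨s.pt, Discrete.natTrans fun j => s.π.app j ≫ fst (K.obj j).1 (K.obj j).2⟩
    let s₂ (s : Cone (K ⋙ tensor C)) : Cone (K ⋙ CategoryTheory.Prod.snd C C) :=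
      ⟨s.pt, Discrete.natTrans fun j => s.π.app j ≫ snd (K.obj j).1 (K.obj j).2⟩
    have e₁ (s : Cone (K ⋙ tensor C)) (j) :
        h₁.lift (s₁ s) ≫ (c.π.app j).1 = s.π.app j ≫ fst (K.obj j).1 (K.obj j).2 := h₁.fac (s₁ s) j
    have e₂ (s : Cone (K ⋙ tensor C)) (j) :
        h₂.lift (s₂ s) ≫ (c.π.app j).2 = s.π.app j ≫ snd (K.obj j).1 (K.obj j).2 := h₂.fac (s₂ s) j
    exact ⟨{
      lift s := lift (h₁.lift (s₁ s)) (h₂.lift (s₂ s))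
      fac s j := by
        change lift _ _ ≫ ((c.π.app j).1 ⊗ₘ (c.π.app j).2) = s.π.app j
        rw [lift_map, e₁, e₂]
        exact lift_comp_fst_snd _
      uniq s m hm := by
        have hm' (j) : m ≫ ((c.π.app j).1 ⊗ₘ (c.π.app j).2) = s.π.app j := hm j
        refine CartesianMonoidalCategory.hom_ext _ _ ?_ ?_
        · rw [lift_fst]
          refine h₁.uniq (s₁ s) _ fun j => ?_
          change (m ≫ fst _ _) ≫ (c.π.app j).1 = s.π.app j ≫ fst (K.obj j).1 (K.obj j).2
          rw [← hm' j, Category.assoc, Category.assoc, tensorHom_fst]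
        · rw [lift_snd]
          refine h₂.uniq (s₂ s) _ fun j => ?_
          change (m ≫ snd _ _) ≫ (c.π.app j).2 = s.π.app j ≫ snd (K.obj j).1 (K.obj j).2
          rw [← hm' j, Category.assoc, Category.assoc, tensorHom_snd] }⟩⟩⟩

end Products

/-- The terminal object: the terminal category with its identity functor. -/
def terminal : CartEndo.{v, u} := ⟨Pt.{u}, 𝟭 _⟩

/-- The product `(C × D, F × G)`. -/
def prodObj (X Y : CartEndo.{v, u}) : CartEndo.{v, u} := ⟨X.C × Y.C, X.F.prod Y.F⟩

/-- The 1-cell to the terminal object. -/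
def toTerminal (X : CartEndo.{v, u}) : X ⟶ terminal :=
  (⟨(Functor.const X.C).obj Pt.pt, preservesFiniteProducts_toPt _, ⟨fun _ => PUnit.unit,
    fun _ _ _ => rfl⟩⟩ : OneCell X terminal)

/-- The first projection. -/
def fstCell (X Y : CartEndo.{v, u}) : prodObj X Y ⟶ X :=
  (⟨CategoryTheory.Prod.fst _ _, preservesFiniteProducts_fst,
    { app c := 𝟙 (X.F.obj c.1)
      naturality c d f := (Category.comp_id _).trans (Category.id_comp _).symm }⟩ :
    OneCell (prodObj X Y) X)

/-- The second projection. -/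
def sndCell (X Y : CartEndo.{v, u}) : prodObj X Y ⟶ Y :=
  (⟨CategoryTheory.Prod.snd _ _, preservesFiniteProducts_snd,
    { app c := 𝟙 (Y.F.obj c.2)
      naturality c d f := (Category.comp_id _).trans (Category.id_comp _).symm }⟩ :
    OneCell (prodObj X Y) Y)

/-- The pairing of two 1-cells. -/
def liftCell (A : Z ⟶ X) (B : Z ⟶ Y) : Z ⟶ prodObj X Y :=
  (⟨Functor.prod' (OneCell.functor A) (OneCell.functor B),
    preservesFiniteProducts_prod' _ _ (OneCell.preserves A) (OneCell.preserves B),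
    { app c := ((OneCell.square A).app c, (OneCell.square B).app c)
      naturality c d f := Prod.ext ((OneCell.square A).naturality f)
        ((OneCell.square B).naturality f) }⟩ : OneCell Z (prodObj X Y))

/-- The pairing of two 2-cells. -/
def liftTwoCell {A B : Z ⟶ prodObj X Y} (φ : A ≫ fstCell X Y ⟶ B ≫ fstCell X Y)
    (ψ : A ≫ sndCell X Y ⟶ B ≫ sndCell X Y) : A ⟶ B :=
  (⟨{ app c := ((TwoCell.nat φ).app c, (TwoCell.nat ψ).app c)
      naturality c d f := Prod.ext ((TwoCell.nat φ).naturality f)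
        ((TwoCell.nat ψ).naturality f) },
    fun c => Prod.ext
      ((congrArg ((TwoCell.nat φ).app (Z.F.obj c) ≫ ·) (Category.comp_id _).symm).trans
        ((TwoCell.comm φ c).trans
          (congrArg (· ≫ X.F.map ((TwoCell.nat φ).app c)) (Category.comp_id _))))
      ((congrArg ((TwoCell.nat ψ).app (Z.F.obj c) ≫ ·) (Category.comp_id _).symm).trans
        ((TwoCell.comm ψ c).trans
          (congrArg (· ≫ Y.F.map ((TwoCell.nat ψ).app c)) (Category.comp_id _))))⟩ : TwoCell A B)

/-- The 2-category of endofunctors on cartesian categories is cartesian, with products computed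
on the underlying categories. -/
instance : CartesianTwoCategory CartEndo.{v, u} where
  one := terminal
  toOne := toTerminal
  toOne_unique f := rfl
  twoOne f g := (⟨⟨fun _ => PUnit.unit, fun _ _ _ => rfl⟩, fun _ => rfl⟩ : TwoCell f g)
  twoOne_unique θ := rfl
  prod := prodObj
  fst := fstCell
  snd := sndCell
  lift := liftCell
  lift_fst f g := OneCell.ext rfl (heq_of_eq (NatTrans.ext (funext fun c => Category.comp_id _)))
  lift_snd f g := OneCell.ext rfl (heq_of_eq (NatTrans.ext (funext fun c => Category.comp_id _)))
  lift_unique h := OneCell.ext rfl (heq_of_eq (NatTrans.ext (funext fun c =>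
    Prod.ext (Category.comp_id _).symm (Category.comp_id _).symm)))
  lift₂ := liftTwoCell
  lift₂_fst _ _ := rfl
  lift₂_snd _ _ := rfl
  lift₂_unique _ := rfl

/-! ### Lax symmetric monoidal endofunctors -/

section Components

open CartesianTwoCategory MagmaObject SymmetricMonoidalData

variable {X Z : CartEndo.{v, u}}

theorem tensor_square (M : MagmaObject X) (x y : Z ⟶ X) (c : Z.C) :
    (OneCell.square (M.tensor x y)).app c =
      (OneCell.functor M.mul).map ((OneCell.square x).app c, (OneCell.square y).app c) ≫
        (OneCell.square M.mul).app ((OneCell.functor x).obj c, (OneCell.functor y).obj c) := rfl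

theorem pr₁_square (c : (prodObj (prodObj X X) X).C) :
    (OneCell.square (pr₁ X)).app c = 𝟙 (X.F.obj c.1.1) := Category.comp_id _

theorem pr₂_square (c : (prodObj (prodObj X X) X).C) :
    (OneCell.square (pr₂ X)).app c = 𝟙 (X.F.obj c.1.2) := Category.comp_id _

theorem pair₂_app {Y : CartEndo.{v, u}} {x x' : Z ⟶ X} {y y' : Z ⟶ Y} (θ : x ⟶ x') (ψ : y ⟶ y')
    (c : Z.C) : (TwoCell.nat (pair₂ θ ψ)).app c =
      ((TwoCell.nat θ).app c, (TwoCell.nat ψ).app c) := by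
  refine Prod.ext ?_ ?_
  · change (TwoCell.nat (eqToHom _ ≫ θ ≫ eqToHom _)).app c = _
    rw [comp_nat, comp_nat, NatTrans.comp_app, NatTrans.comp_app, eqToHom_nat, eqToHom_nat]
    exact (Category.id_comp _).trans (Category.comp_id _)
  · change (TwoCell.nat (eqToHom _ ≫ ψ ≫ eqToHom _)).app c = _
    rw [comp_nat, comp_nat, NatTrans.comp_app, NatTrans.comp_app, eqToHom_nat, eqToHom_nat]
    exact (Category.id_comp _).trans (Category.comp_id _)

theorem tensor₂_app (M : MagmaObject X) {x x' y y' : Z ⟶ X} (θ : x ⟶ x') (ψ : y ⟶ y') (c : Z.C) :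
    (TwoCell.nat (M.tensor₂ θ ψ)).app c =
      (OneCell.functor M.mul).map ((TwoCell.nat θ).app c, (TwoCell.nat ψ).app c) :=
  congrArg (OneCell.functor M.mul).map (pair₂_app θ ψ c)

theorem assocAt_app (M : SymmetricMonoidalData X) (x y z : Z ⟶ X) (c : Z.C) :
    (TwoCell.nat (M.assocAt x y z)).app c = (TwoCell.nat M.assoc.hom).app
      (((OneCell.functor x).obj c, (OneCell.functor y).obj c), (OneCell.functor z).obj c) := by
  rw [assocAt, comp_nat, comp_nat, NatTrans.comp_app, NatTrans.comp_app, eqToHom_nat, eqToHom_nat]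
  exact (Category.id_comp _).trans (Category.comp_id _)

theorem leftUnitAt_app (M : SymmetricMonoidalData X) (x : Z ⟶ X) (c : Z.C) :
    (TwoCell.nat (M.leftUnitAt x)).app c =
      (TwoCell.nat M.leftUnit.hom).app ((OneCell.functor x).obj c) := by
  rw [leftUnitAt, comp_nat, comp_nat, NatTrans.comp_app, NatTrans.comp_app, eqToHom_nat,
    eqToHom_nat]
  exact (Category.id_comp _).trans (Category.comp_id _)

theorem rightUnitAt_app (M : SymmetricMonoidalData X) (x : Z ⟶ X) (c : Z.C) :
    (TwoCell.nat (M.rightUnitAt x)).app c =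
      (TwoCell.nat M.rightUnit.hom).app ((OneCell.functor x).obj c) := by
  rw [rightUnitAt, comp_nat, comp_nat, NatTrans.comp_app, NatTrans.comp_app, eqToHom_nat,
    eqToHom_nat]
  exact (Category.id_comp _).trans (Category.comp_id _)

theorem symmAt_app (M : SymmetricMonoidalData X) (x y : Z ⟶ X) (c : Z.C) :
    (TwoCell.nat (M.symmAt x y)).app c = (TwoCell.nat M.symm.hom).app
      ((OneCell.functor x).obj c, (OneCell.functor y).obj c) := by
  rw [symmAt, comp_nat, comp_nat, NatTrans.comp_app, NatTrans.comp_app, eqToHom_nat, eqToHom_nat]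
  exact (Category.id_comp _).trans (Category.comp_id _)

end Components

section OfLaxBraided

open Functor.LaxMonoidal

variable {C : Type u} [Category.{v} C] [CartesianMonoidalCategory C] [BraidedCategory C]
  (F : C ⥤ C) (L : F.LaxBraided)

/-- The endofunctor `F` of the cartesian category `C` as an object of the 2-category. -/
abbrev of {C : Type u} [Category.{v} C] [CartesianMonoidalCategory C] (F : C ⥤ C) :
    CartEndo.{v, u} := ⟨C, F⟩

/-- The cartesian product of `C` and the terminal object of `C`, as 1-cells of the 2-category
whose colax squares are the laxator `F x × F y ⟶ F (x × y)` and the unit `1 ⟶ F 1` of a lax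
symmetric monoidal structure on `F`. -/
def productMagma : MagmaObject (of F) where
  mul := (⟨tensor C, preservesFiniteProducts_tensor,
    { app c := μ F c.1 c.2
      naturality c d f := μ_natural F f.1 f.2 }⟩ : OneCell (prodObj (of F) (of F)) (of F))
  unit := (⟨(Functor.const _).obj (𝟙_ C), preservesFiniteProducts_unit,
    { app _ := Functor.LaxMonoidal.ε F
      naturality _ _ _ := (Category.id_comp _).trans
        ((congrArg (Functor.LaxMonoidal.ε F ≫ ·) (F.map_id _)).trans (Category.comp_id _)).symm }⟩ :
    OneCell terminal (of F))

/-- The canonical associativity, unit and symmetry isomorphisms of the cartesian product. -/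
def productData : SymmetricMonoidalData (of F) where
  toMagmaObject := productMagma F L
  assoc := isoMk (NatIso.ofComponents (fun c => α_ c.1.1 c.1.2 c.2)
    (fun f => associator_naturality f.1.1 f.1.2 f.2)) (fun c => by
      rw [tensor_square, tensor_square, tensor_square, tensor_square]
      erw [pr₁_square, pr₂_square]
      have h := associativity F c.1.1 c.1.2 c.2
      change (α_ (F.obj c.1.1) (F.obj c.1.2) (F.obj c.2)).hom ≫
        (𝟙 (F.obj c.1.1) ⊗ₘ ((𝟙 (F.obj c.1.2) ⊗ₘ 𝟙 (F.obj c.2)) ≫ μ F c.1.2 c.2)) ≫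
          μ F c.1.1 (c.1.2 ⊗ c.2) =
        ((((𝟙 (F.obj c.1.1) ⊗ₘ 𝟙 (F.obj c.1.2)) ≫ μ F c.1.1 c.1.2) ⊗ₘ 𝟙 (F.obj c.2)) ≫
          μ F (c.1.1 ⊗ c.1.2) c.2) ≫ F.map (α_ c.1.1 c.1.2 c.2).hom
      simpa using h.symm)
  leftUnit := isoMk (NatIso.ofComponents (fun c => λ_ c) (fun {c d} f => by
      change (𝟙 (𝟙_ C) ⊗ₘ f) ≫ (λ_ d).hom = (λ_ c).hom ≫ f
      simp)) (fun c => by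
      have h := left_unitality F c
      change (λ_ (F.obj c)).hom ≫ 𝟙 (F.obj c) =
        ((((𝟙 (𝟙_ C)) ≫ Functor.LaxMonoidal.ε F) ⊗ₘ 𝟙 (F.obj c)) ≫ μ F (𝟙_ C) c) ≫
          F.map (λ_ c).hom
      simpa using h)
  rightUnit := isoMk (NatIso.ofComponents (fun c => ρ_ c) (fun {c d} f => by
      change (f ⊗ₘ 𝟙 (𝟙_ C)) ≫ (ρ_ d).hom = (ρ_ c).hom ≫ f
      simp)) (fun c => by
      have h := right_unitality F c
      change (ρ_ (F.obj c)).hom ≫ 𝟙 (F.obj c) =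
        ((𝟙 (F.obj c) ⊗ₘ ((𝟙 (𝟙_ C)) ≫ Functor.LaxMonoidal.ε F)) ≫ μ F c (𝟙_ C)) ≫
          F.map (ρ_ c).hom
      simpa using h)
  symm := isoMk (NatIso.ofComponents (fun c => β_ c.1 c.2)
    (fun f => BraidedCategory.braiding_naturality f.1 f.2)) (fun c => by
      have h := Functor.LaxBraided.braided (F := F) c.1 c.2
      change (β_ (F.obj c.1) (F.obj c.2)).hom ≫
        (𝟙 (F.obj c.2) ⊗ₘ 𝟙 (F.obj c.1)) ≫ μ F c.2 c.1 =
          ((𝟙 (F.obj c.1) ⊗ₘ 𝟙 (F.obj c.2)) ≫ μ F c.1 c.2) ≫ F.map (β_ c.1 c.2).hom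
      simpa using h.symm)

theorem productData_coherent : (productData F L).Coherent where
  pentagon w x y z := by
    ext c
    simp only [comp_nat, NatTrans.comp_app, tensor₂_app, assocAt_app]
    have h (a b d e : C) : ((α_ a b d).hom ⊗ₘ 𝟙 e) ≫ (α_ a (b ⊗ d) e).hom ≫
        (𝟙 a ⊗ₘ (α_ b d e).hom) = (α_ (a ⊗ b) d e).hom ≫ (α_ a b (d ⊗ e)).hom := by
      simp [MonoidalCategory.pentagon]
    exact h _ _ _ _
  triangle x y := by
    ext c
    simp only [comp_nat, NatTrans.comp_app, tensor₂_app, assocAt_app, leftUnitAt_app,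
      rightUnitAt_app]
    have h (a b : C) : (α_ a (𝟙_ C) b).hom ≫ (𝟙 a ⊗ₘ (λ_ b).hom) = (ρ_ a).hom ⊗ₘ 𝟙 b := by
      simp
    exact h _ _
  hexagon x y z := by
    ext c
    simp only [comp_nat, NatTrans.comp_app, tensor₂_app, assocAt_app, symmAt_app]
    have h (a b d : C) : (α_ a b d).hom ≫ (β_ a (b ⊗ d)).hom ≫ (α_ b d a).hom =
        ((β_ a b).hom ⊗ₘ 𝟙 d) ≫ (α_ b a d).hom ≫ (𝟙 b ⊗ₘ (β_ a d).hom) := by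
      simp [BraidedCategory.hexagon_forward]
    exact h _ _ _
  symmetry x y := by
    ext c
    simp only [comp_nat, NatTrans.comp_app, symmAt_app]
    exact SymmetricCategory.symmetry (C := C) _ _

/-- The symmetric monoidal structure on `(C, F)` given by the cartesian product of `C` and a lax
symmetric monoidal structure on `F` with respect to the cartesian product. -/
def productStructure : SymmetricMonoidalStructure (of F) where
  toSymmetricMonoidalData := productData F L
  coherent := productData_coherent F L

/-- The construction of symmetric monoidal structures on `(C, F)` from the lax symmetric monoidal
structures on `F` with respect to the cartesian product of `C`, as a functor whose domain is the
set of lax symmetric monoidal structures (a discrete category). -/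
def productStructureFunctor :
    Discrete F.LaxBraided ⥤ SymmetricMonoidalStructure (of F) :=
  Discrete.functor (productStructure F)

end OfLaxBraided

end CartEndo
end Endofunctors
end TwoAlgebra

/-! The point is that a 1-cell preserves finite products, so a symmetric monoidal structure on `(C,
F)` has no choice but to be cartesian. The unit is a product-preserving functor out of the terminal
category, hence picks a terminal object `1`. In `C × C` the object `(a, b)` is the product of `(a,
1)` and `(1, b)`; since the multiplication preserves this product, `a ⊗ b` is the product of `a ⊗ 1
≅ a` and `1 ⊗ b ≅ b` (`isLimitWhiskers`, `isLimitProj`).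

The remaining data are the colax squares of the multiplication and of the unit, which have the shape
of a laxator `F a ⊗ F b ⟶ F (a ⊗ b)` and of a map `1 ⟶ F 1`. That the associativity, unit and
symmetry isomorphisms are 2-cells says precisely that these maps satisfy the axioms of a lax
symmetric monoidal functor. So `F` is lax symmetric monoidal for `⊗`. The identity functor of `C` is
strong symmetric monoidal between `⊗` and the chosen product, being product-preserving between
cartesian structures; transport along it gives a lax structure on `F` for `×`, and its structure
maps form an isomorphism of structures (`comparison`). This is essential surjectivity.

For full faithfulness, a morphism between two structures built on the same `×` has components `1 ⟶
1` and `a × b ⟶ a × b`. The first is the identity because `1` is terminal. The second commutes with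
both projections, by naturality and unit compatibility, so it is the identity too (`homMul_eq_id`).
The 2-cell condition for identity components says that the two lax structures coincide
(`eq_of_hom`). -/

namespace TwoAlgebra

open CartesianTwoCategory Limits MonoidalCategory CartesianMonoidalCategory

namespace CartEndo

/-- The natural isomorphism underlying an invertible 2-cell. -/
def natIso {X Y : CartEndo.{v, u}} {A B : X ⟶ Y} (e : A ≅ B) :
    OneCell.functor A ≅ OneCell.functor B where
  hom := TwoCell.nat e.hom
  inv := TwoCell.nat e.inv
  hom_inv_id := congrArg TwoCell.nat e.hom_inv_id
  inv_hom_id := congrArg TwoCell.nat e.inv_hom_id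

theorem nat_app_congr {X Y : CartEndo.{v, u}} {A B : X ⟶ Y} {φ ψ : A ⟶ B} (h : φ = ψ) (c : X.C) :
    (TwoCell.nat φ).app c = (TwoCell.nat ψ).app c := by rw [h]

end CartEndo

/-! ### The cartesian monoidal structure induced on the underlying category -/

open CartEndo

/-- The underlying category of an object with a symmetric monoidal structure, to be equipped with
the induced monoidal structure. -/
def Carrier {X : CartEndo.{v, u}} (_ : SymmetricMonoidalStructure X) : Type u := X.C

namespace Carrier

variable {X : CartEndo.{v, u}} (M : SymmetricMonoidalStructure X)

instance : Category.{v} (Carrier M) := inferInstanceAs (Category X.C)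

/-- The underlying functor of the multiplication. -/
def mulFunctor : X.C × X.C ⥤ X.C := OneCell.functor M.mul

/-- The synonym `Carrier M` keeps this structure apart from the chosen products of `X.C`, which live
on the same category. -/
instance : MonoidalCategoryStruct (Carrier M) where
  tensorObj a b := (mulFunctor M).obj (a, b)
  whiskerLeft a _ _ f := (mulFunctor M).map (Prod.mkHom (𝟙 (a : X.C)) f)
  whiskerRight f b := (mulFunctor M).map (Prod.mkHom f (𝟙 (b : X.C)))
  tensorHom f g := (mulFunctor M).map (Prod.mkHom f g)
  tensorUnit := (OneCell.functor M.unit).obj Pt.pt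
  associator a b c := (natIso M.assoc).app ((a, b), c)
  leftUnitor a := (natIso M.leftUnit).app a
  rightUnitor a := (natIso M.rightUnit).app a

instance : MonoidalCategory (Carrier M) := MonoidalCategory.ofTensorHom
  (id_tensorHom_id := fun a b => (mulFunctor M).map_id (a, b))
  (id_tensorHom := fun _ _ _ _ => rfl)
  (tensorHom_id := fun _ _ => rfl)
  (tensorHom_comp_tensorHom := fun f₁ f₂ g₁ g₂ =>
    ((mulFunctor M).map_comp (Prod.mkHom f₁ f₂) (Prod.mkHom g₁ g₂)).symm)
  (associator_naturality := fun {a₁ a₂ a₃ b₁ b₂ b₃} f₁ f₂ f₃ =>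
    (TwoCell.nat M.assoc.hom).naturality (X := ((a₁, a₂), a₃)) (Y := ((b₁, b₂), b₃))
      (Prod.mkHom (Prod.mkHom f₁ f₂) f₃))
  (leftUnitor_naturality := fun {a b} f =>
    -- Naturality of the 2-cell involves the image under the unit functor of the identity of `pt`,
    -- which equals the identity of the unit object only by functoriality.
    (congrArg (fun t => (mulFunctor M).map (Prod.mkHom t f) ≫ (TwoCell.nat M.leftUnit.hom).app b)
      ((OneCell.functor M.unit).map_id Pt.pt).symm).trans
        ((TwoCell.nat M.leftUnit.hom).naturality f))
  (rightUnitor_naturality := fun {a b} f =>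
    (congrArg (fun t => (mulFunctor M).map (Prod.mkHom f t) ≫ (TwoCell.nat M.rightUnit.hom).app b)
      ((OneCell.functor M.unit).map_id Pt.pt).symm).trans
        ((TwoCell.nat M.rightUnit.hom).naturality f))
  (pentagon := fun a b c d => by
    have h {Z : CartEndo.{v, u}} (w x y z : Z ⟶ X) (t : Z.C) :=
      nat_app_congr (M.coherent.pentagon w x y z) t
    simp only [comp_nat, NatTrans.comp_app, tensor₂_app, assocAt_app] at h
    -- The axiom is stated at generalized elements; the four projections out of the fourfold product
    -- are the universal ones, and evaluating there at the object `(((a, b), c), d)` gives the usual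
    -- pentagon. The other axioms are extracted in the same way.
    exact h (Z := prod (prod (prod X X) X) X) (fst _ _ ≫ pr₁ X) (fst _ _ ≫ pr₂ X)
      (fst _ _ ≫ pr₃ X) (snd _ _) (((a, b), c), d))
  (triangle := fun a b => by
    have h {Z : CartEndo.{v, u}} (x y : Z ⟶ X) (t : Z.C) :=
      nat_app_congr (M.coherent.triangle x y) t
    simp only [comp_nat, NatTrans.comp_app, tensor₂_app, assocAt_app, leftUnitAt_app,
      rightUnitAt_app] at h
    exact h (fst X X) (snd X X) (a, b))

/-- The symmetry of the induced monoidal structure. -/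
def braid (a b : Carrier M) : a ⊗ b ≅ b ⊗ a := (natIso M.symm).app (a, b)

theorem braid_naturality {a b c d : Carrier M} (f : a ⟶ b) (g : c ⟶ d) :
    (f ⊗ₘ g) ≫ (braid M b d).hom = (braid M a c).hom ≫ (g ⊗ₘ f) :=
  (TwoCell.nat M.symm.hom).naturality (X := (a, c)) (Y := (b, d)) (Prod.mkHom f g)

theorem braid_symm (a b : Carrier M) : (braid M a b).hom ≫ (braid M b a).hom = 𝟙 _ := by
  have h {Z : CartEndo.{v, u}} (x y : Z ⟶ X) (t : Z.C) :=
    nat_app_congr (M.coherent.symmetry x y) t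
  simp only [comp_nat, NatTrans.comp_app, symmAt_app] at h
  exact h (fst X X) (snd X X) (a, b)

theorem braid_hexagon (a b c : Carrier M) :
    (α_ a b c).hom ≫ (braid M a (b ⊗ c)).hom ≫ (α_ b c a).hom =
      (braid M a b).hom ▷ c ≫ (α_ b a c).hom ≫ b ◁ (braid M a c).hom := by
  have h {Z : CartEndo.{v, u}} (x y z : Z ⟶ X) (t : Z.C) :=
    nat_app_congr (M.coherent.hexagon x y z) t
  simp only [comp_nat, NatTrans.comp_app, tensor₂_app, assocAt_app, symmAt_app] at h
  exact h (pr₁ X) (pr₂ X) (pr₃ X) ((a, b), c)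

instance : BraidedCategory (Carrier M) where
  braiding := braid M
  braiding_naturality_right a _ _ f := by
    simpa using braid_naturality M (𝟙 a) f
  braiding_naturality_left f c := by
    simpa using braid_naturality M f (𝟙 c)
  hexagon_forward := braid_hexagon M
  hexagon_reverse a b c := by
    -- The reverse hexagon follows from the forward one at `c, a, b` by symmetry. After
    -- precomposition with these three isomorphisms the left side collapses to an identity, while on
    -- the right the forward hexagon applies and its result cancels against the remaining factors.
    rw [← cancel_epi (α_ a b c).hom, ← cancel_epi (braid M c (a ⊗ b)).hom,
      ← cancel_epi (α_ c a b).hom]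
    have h := braid_hexagon M c a b
    rw [Iso.hom_inv_id_assoc, reassoc_of% (braid_symm M c (a ⊗ b)), Iso.hom_inv_id,
      reassoc_of% h, ← MonoidalCategory.whiskerLeft_comp_assoc, braid_symm]
    simp [← MonoidalCategory.comp_whiskerRight, braid_symm]

/-- The unit of the induced monoidal structure is terminal. -/
noncomputable def isTerminalUnit : IsTerminal (𝟙_ (Carrier M)) :=
  have := OneCell.preserves M.unit
  IsTerminal.isTerminalObj (OneCell.functor M.unit) Pt.pt
    (IsTerminal.ofUniqueHom (fun _ => PUnit.unit) (fun _ _ => rfl))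

/-- The first projection. -/
noncomputable def proj₁ (a b : Carrier M) : a ⊗ b ⟶ a :=
  a ◁ (isTerminalUnit M).from b ≫ (ρ_ a).hom

/-- The second projection. -/
noncomputable def proj₂ (a b : Carrier M) : a ⊗ b ⟶ b :=
  (isTerminalUnit M).from a ▷ b ≫ (λ_ b).hom

/-- The multiplication preserves the product `(a, b) = (a, 1) × (1, b)`. -/
noncomputable def isLimitWhiskers (a b : Carrier M) :
    IsLimit (BinaryFan.mk (a ◁ (isTerminalUnit M).from b) ((isTerminalUnit M).from a ▷ b)) := by
  have : PreservesFiniteProducts (mulFunctor M) := OneCell.preserves M.mul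
  refine mapIsLimitOfPreservesOfIsLimit (mulFunctor M)
    (Prod.mkHom (𝟙 (a : X.C)) ((isTerminalUnit M).from b))
    (Prod.mkHom ((isTerminalUnit M).from a) (𝟙 (b : X.C))) ?_
  -- Only `f.1` and `g.2` carry information: `f.2` and `g.1` land in the terminal unit.
  refine BinaryFan.IsLimit.mk _ (fun f g => Prod.mkHom f.1 g.2) (fun f g => ?_) (fun f g => ?_)
    (fun f g m hf hg => ?_)
  · exact Prod.ext (Category.comp_id f.1) ((isTerminalUnit M).hom_ext _ _)
  · exact Prod.ext ((isTerminalUnit M).hom_ext _ _) (Category.comp_id g.2)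
  · subst hf hg
    exact Prod.ext (Category.comp_id m.1).symm (Category.comp_id m.2).symm

/-- The induced monoidal structure is cartesian. -/
noncomputable def isLimitProj (a b : Carrier M) :
    IsLimit (BinaryFan.mk (proj₁ M a b) (proj₂ M a b)) :=
  BinaryFan.IsLimit.mk _
    (fun f g => (isLimitWhiskers M a b).lift (BinaryFan.mk (f ≫ (ρ_ a).inv) (g ≫ (λ_ b).inv)))
    (fun f g => by
      have h := (isLimitWhiskers M a b).fac (BinaryFan.mk (f ≫ (ρ_ a).inv) (g ≫ (λ_ b).inv))
        ⟨.left⟩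
      dsimp at h
      simp [proj₁, reassoc_of% h])
    (fun f g => by
      have h := (isLimitWhiskers M a b).fac (BinaryFan.mk (f ≫ (ρ_ a).inv) (g ≫ (λ_ b).inv))
        ⟨.right⟩
      dsimp at h
      simp [proj₂, reassoc_of% h])
    (fun f g m hf hg => by
      apply BinaryFan.IsLimit.hom_ext (isLimitWhiskers M a b)
      · rw [(isLimitWhiskers M a b).fac]
        simp [← hf, proj₁]
      · rw [(isLimitWhiskers M a b).fac]
        simp [← hg, proj₂])

noncomputable instance : CartesianMonoidalCategory (Carrier M) where
  isTerminalTensorUnit := isTerminalUnit M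
  fst := proj₁ M
  snd := proj₂ M
  tensorProductIsBinaryProduct := isLimitProj M

/-! ### Colax squares as a lax symmetric monoidal structure -/

/-- The endofunctor on the carrier. -/
def endo : Carrier M ⥤ Carrier M := X.F

/-- The colax square of the multiplication. -/
def laxator (a b : Carrier M) : (endo M).obj a ⊗ (endo M).obj b ⟶ (endo M).obj (a ⊗ b) :=
  (OneCell.square M.mul).app (a, b)

/-- The colax square of the unit. -/
def unitSquare : 𝟙_ (Carrier M) ⟶ (endo M).obj (𝟙_ (Carrier M)) :=
  (OneCell.square M.unit).app Pt.pt

theorem laxator_naturality {a b c d : Carrier M} (f : a ⟶ b) (g : c ⟶ d) :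
    ((endo M).map f ⊗ₘ (endo M).map g) ≫ laxator M b d =
      laxator M a c ≫ (endo M).map (f ⊗ₘ g) :=
  (OneCell.square M.mul).naturality (X := (a, c)) (Y := (b, d)) (Prod.mkHom f g)

/-- The colax squares of the multiplication and the unit, as a lax symmetric monoidal structure
with respect to the induced monoidal structure. -/
instance : (endo M).LaxBraided where
  ε := unitSquare M
  μ := laxator M
  μ_natural_left f c := by
    simpa using laxator_naturality M f (𝟙 c)
  μ_natural_right c f := by
    simpa using laxator_naturality M (𝟙 c) f
  associativity a b c := by
    -- This is the 2-cell condition of the associator, with the squares of the composite 1-cells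
    -- unfolded; the identities come from the squares of the projections.
    have h : (α_ ((endo M).obj a) ((endo M).obj b) ((endo M).obj c)).hom ≫
        ((𝟙 _ ≫ 𝟙 _) ⊗ₘ (((𝟙 _ ≫ 𝟙 _) ⊗ₘ 𝟙 _) ≫ laxator M b c)) ≫ laxator M a (b ⊗ c) =
      (((((𝟙 _ ≫ 𝟙 _) ⊗ₘ (𝟙 _ ≫ 𝟙 _)) ≫ laxator M a b) ⊗ₘ 𝟙 _) ≫ laxator M (a ⊗ b) c) ≫
        (endo M).map (α_ a b c).hom := TwoCell.comm M.assoc.hom ((a, b), c)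
    simpa using h.symm
  left_unitality a := by
    -- The square of the composite through the terminal object contains the unit functor applied to
    -- an identity. It is named `t` so that it can be replaced by the identity, to which it is only
    -- propositionally equal.
    obtain ⟨t, rfl, h⟩ : ∃ t : 𝟙_ (Carrier M) ⟶ 𝟙_ _, t = 𝟙 _ ∧
        (λ_ ((endo M).obj a)).hom ≫ 𝟙 _ = (((t ≫ unitSquare M) ⊗ₘ 𝟙 _) ≫ laxator M (𝟙_ _) a) ≫
          (endo M).map (λ_ a).hom :=
      ⟨_, (OneCell.functor M.unit).map_id Pt.pt, TwoCell.comm M.leftUnit.hom a⟩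
    simpa using h
  right_unitality a := by
    obtain ⟨t, rfl, h⟩ : ∃ t : 𝟙_ (Carrier M) ⟶ 𝟙_ _, t = 𝟙 _ ∧
        (ρ_ ((endo M).obj a)).hom ≫ 𝟙 _ = ((𝟙 _ ⊗ₘ (t ≫ unitSquare M)) ≫ laxator M a (𝟙_ _)) ≫
          (endo M).map (ρ_ a).hom :=
      ⟨_, (OneCell.functor M.unit).map_id Pt.pt, TwoCell.comm M.rightUnit.hom a⟩
    simpa using h
  braided a b := by
    have h : (β_ ((endo M).obj a) ((endo M).obj b)).hom ≫ (𝟙 _ ⊗ₘ 𝟙 _) ≫ laxator M b a =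
      ((𝟙 _ ⊗ₘ 𝟙 _) ≫ laxator M a b) ≫ (endo M).map (β_ a b).hom :=
        TwoCell.comm M.symm.hom (a, b)
    simpa using h.symm

end Carrier
-- Invertibility of morphisms of structures
namespace SymmetricMonoidalStructure

open MagmaObject Bicategory

variable {K : Type w₃} [Bicategory.{w₁, w₂} K] [Bicategory.Strict K] [CartesianTwoCategory K] {X : K}

theorem mulAt_hom_inv_id {S T : MagmaObject X} (e : S.mul ≅ T.mul) {Z : K} (x y : Z ⟶ X) :
    mulAt e.hom x y ≫ mulAt e.inv x y = 𝟙 (S.tensor x y) := by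
  rw [← mulAt_comp, e.hom_inv_id, mulAt_id]

theorem mulAt_inv_hom_id {S T : MagmaObject X} (e : S.mul ≅ T.mul) {Z : K} (x y : Z ⟶ X) :
    mulAt e.inv x y ≫ mulAt e.hom x y = 𝟙 (T.tensor x y) := mulAt_hom_inv_id e.symm x y

theorem unitComp_inv_hom_id {S T : MagmaObject X} (e : S.unit ≅ T.unit) (Z : K) :
    unitComp e.inv Z ≫ unitComp e.hom Z = 𝟙 (T.unitAt Z) := by
  rw [← unitComp_comp, e.inv_hom_id, unitComp_id]

theorem tensor₂_hom_inv_id (M : MagmaObject X) {Z : K} {x x' y y' : Z ⟶ X} {θ : x ⟶ x'}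
    {θ' : x' ⟶ x} {ψ : y ⟶ y'} {ψ' : y' ⟶ y} (h : θ ≫ θ' = 𝟙 x) (h' : ψ ≫ ψ' = 𝟙 y) :
    M.tensor₂ θ ψ ≫ M.tensor₂ θ' ψ' = 𝟙 (M.tensor x y) := by
  rw [← tensor₂_comp, h, h', tensor₂_id]

/-- Morphisms of symmetric monoidal structures are invertible. -/
def Hom.inv {S T : SymmetricMonoidalStructure X} (f : Hom S T) : Hom T S where
  mulIso := f.mulIso.symm
  unitIso := f.unitIso.symm
  assoc_comp {Z} x y z := by
    have h₁ := tensor₂_hom_inv_id T.toMagmaObject (mulAt_inv_hom_id f.mulIso x y)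
      (Category.comp_id (𝟙 z))
    have h₂ := tensor₂_hom_inv_id T.toMagmaObject (Category.comp_id (𝟙 x))
      (mulAt_hom_inv_id f.mulIso y z)
    dsimp only [Iso.symm_hom]
    -- Identities, written as composites of components of `f` with their inverses, are inserted
    -- after `S.assocAt x y z` so that the compatibility of `f` can trade it for `T.assocAt x y z`;
    -- the other factors cancel in pairs.
    rw [← mulAt_naturality_assoc, ← mulAt_naturality, ← Category.comp_id (S.assocAt x y z),
      ← mulAt_hom_inv_id f.mulIso x (S.tensor y z),
      ← Category.id_comp (mulAt f.mulIso.inv x (S.tensor y z)), ← h₂, Category.assoc,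
      ← reassoc_of% (f.assoc_comp x y z), reassoc_of% (mulAt_inv_hom_id f.mulIso (S.tensor x y) z),
      reassoc_of% h₁, reassoc_of% h₂]
  leftUnit_comp {Z} x := by
    have h := tensor₂_hom_inv_id T.toMagmaObject (unitComp_inv_hom_id f.unitIso Z)
      (Category.comp_id (𝟙 x))
    dsimp only [Iso.symm_hom]
    rw [← f.leftUnit_comp x, ← mulAt_naturality_assoc, reassoc_of% (mulAt_inv_hom_id f.mulIso),
      reassoc_of% h]
  rightUnit_comp {Z} x := by
    have h := tensor₂_hom_inv_id T.toMagmaObject (Category.comp_id (𝟙 x))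
      (unitComp_inv_hom_id f.unitIso Z)
    dsimp only [Iso.symm_hom]
    rw [← f.rightUnit_comp x, ← mulAt_naturality_assoc, reassoc_of% (mulAt_inv_hom_id f.mulIso),
      reassoc_of% h]
  symm_comp x y := by
    dsimp only [Iso.symm_hom]
    rw [← Category.comp_id (S.symmAt x y), ← mulAt_hom_inv_id f.mulIso y x,
      ← reassoc_of% (f.symm_comp x y), reassoc_of% (mulAt_inv_hom_id f.mulIso)]

/-- The isomorphism given by a morphism of symmetric monoidal structures. -/
def Hom.toIso {S T : SymmetricMonoidalStructure X} (f : Hom S T) : S ≅ T where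
  hom := f
  inv := f.inv
  hom_inv_id := Hom.ext f.mulIso.self_symm_id f.unitIso.self_symm_id
  inv_hom_id := Hom.ext f.mulIso.symm_self_id f.unitIso.symm_self_id

end SymmetricMonoidalStructure

/-! ### Comparison with the chosen product -/

namespace Carrier

open Functor.LaxMonoidal Functor.OplaxMonoidal

variable {C : Type u} [Category.{v} C] [CartesianMonoidalCategory C] {F : C ⥤ C}
  (M : SymmetricMonoidalStructure (of F))

/-- The identity functor from the carrier to the underlying category. -/
def toBase : Carrier M ⥤ C := 𝟭 C

/-- The identity functor from the underlying category to the carrier. -/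
def ofBase : C ⥤ Carrier M := 𝟭 C

instance : PreservesFiniteProducts (toBase M) := inferInstanceAs (PreservesFiniteProducts (𝟭 C))

instance : PreservesFiniteProducts (ofBase M) := inferInstanceAs (PreservesFiniteProducts (𝟭 C))

variable [BraidedCategory C]

/-- Source and target are both cartesian monoidal, so preservation of finite products already makes
the functor strong monoidal and compatible with the braidings. -/
noncomputable instance : (toBase M).Braided := .ofChosenFiniteProducts _

noncomputable instance : (ofBase M).Braided := .ofChosenFiniteProducts _

/-- The lax symmetric monoidal structure with respect to the cartesian product determined by a
symmetric monoidal structure. -/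
noncomputable abbrev laxBraided : F.LaxBraided :=
  inferInstanceAs ((ofBase M ⋙ endo M ⋙ toBase M).LaxBraided)

/-- Both are the canonical map from the induced product to the chosen one, having the same
projections. This is needed because the laxator of `laxBraided M` ends with `μ (ofBase M)`, whereas
`mulNatIso` is made from `δ (toBase M)`. -/
theorem δ_toBase_eq_μ_ofBase (a b : C) :
    (δ (toBase M) ((ofBase M).obj a) ((ofBase M).obj b) : _ ⟶ a ⊗ b) =
      (toBase M).map (μ (ofBase M) a b) := by
  apply CartesianMonoidalCategory.hom_ext
  · exact (δ_fst (toBase M) _ _).trans (Functor.Monoidal.μ_fst (ofBase M) a b).symm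
  · exact (δ_snd (toBase M) _ _).trans (Functor.Monoidal.μ_snd (ofBase M) a b).symm

theorem δ_braiding {D E : Type*} [Category* D] [Category* E] [MonoidalCategory D]
    [MonoidalCategory E] [BraidedCategory D] [BraidedCategory E] (G : D ⥤ E) [G.Braided] (a b : D) :
    δ G a b ≫ (β_ (G.obj a) (G.obj b)).hom = G.map (β_ a b).hom ≫ δ G b a := by
  rw [Functor.map_braiding]
  simp

/-- The comparison isomorphism between the multiplication and the product. -/
noncomputable def mulNatIso : OneCell.functor M.mul ≅ tensor C :=
  NatIso.ofComponents (fun c => (Functor.Monoidal.μIso (toBase M) c.1 c.2).symm)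
    (fun {c d} f => by
      have h := δ_natural (toBase M) (X := c.1) (Y := d.1) (X' := c.2) (Y' := d.2) f.1 f.2
      exact h.symm)

/-- The comparison isomorphism between the unit and the terminal object. -/
noncomputable def unitNatIso :
    OneCell.functor M.unit ≅ (Functor.const Pt.{u}).obj (𝟙_ C) :=
  NatIso.ofComponents (fun _ => (Functor.Monoidal.εIso (toBase M)).symm)
    (fun _ => toUnit_unique _ _)

theorem mulNatIso_square (c : C × C) :
    (mulNatIso M).hom.app (F.obj c.1, F.obj c.2) ≫ (laxBraided M).μ c.1 c.2 =
      (OneCell.square M.mul).app c ≫ F.map ((mulNatIso M).hom.app c) := by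
  -- The bracket together with the last factor is the laxator of the composite `ofBase M ⋙ endo M ⋙
  -- toBase M`; its leading `μ (toBase M)` cancels against `δ (toBase M)`.
  have h : δ (toBase M) ((endo M).obj c.1) ((endo M).obj c.2) ≫
      (μ (toBase M) ((endo M).obj c.1) ((endo M).obj c.2) ≫ (toBase M).map (laxator M c.1 c.2)) ≫
        (toBase M).map ((endo M).map (μ (ofBase M) c.1 c.2)) =
      (toBase M).map (laxator M c.1 c.2) ≫
        (toBase M).map ((endo M).map (μ (ofBase M) c.1 c.2)) := by
    simp
  exact h.trans (congrArg (fun t => (OneCell.square M.mul).app c ≫ F.map t)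
    (δ_toBase_eq_μ_ofBase M c.1 c.2).symm)

theorem unitNatIso_square :
    (unitNatIso M).hom.app Pt.pt ≫ (laxBraided M).ε =
      (OneCell.square M.unit).app Pt.pt ≫ F.map ((unitNatIso M).hom.app Pt.pt) := by
  have h : η (toBase M) ≫ (ε (toBase M) ≫ (toBase M).map (unitSquare M)) ≫
      (toBase M).map ((endo M).map (ε (ofBase M))) =
      (toBase M).map (unitSquare M) ≫ (toBase M).map ((endo M).map (ε (ofBase M))) := by
    simp
  exact h.trans (congrArg (fun t => (OneCell.square M.unit).app Pt.pt ≫ F.map t)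
    (toUnit_unique (C := C) _ _))

/-- The comparison of a symmetric monoidal structure with the cartesian one. -/
noncomputable def comparison :
    SymmetricMonoidalStructure.Hom M (productStructure F (laxBraided M)) where
  mulIso := isoMk (mulNatIso M) (mulNatIso_square M)
  unitIso := isoMk (unitNatIso M) (fun _ => unitNatIso_square M)
  assoc_comp x y z := by
    ext c
    simp only [comp_nat, NatTrans.comp_app, tensor₂_app, assocAt_app]
    -- On components, the compatibilities required of the comparison are the oplax symmetric
    -- monoidal axioms of `toBase M`.
    have h := Functor.OplaxMonoidal.associativity (toBase M) ((OneCell.functor x).obj c)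
      ((OneCell.functor y).obj c) ((OneCell.functor z).obj c)
    rw [← MonoidalCategory.tensorHom_id, ← MonoidalCategory.id_tensorHom] at h
    exact h
  leftUnit_comp x := by
    ext c
    simp only [comp_nat, NatTrans.comp_app, tensor₂_app, leftUnitAt_app]
    have h := Functor.OplaxMonoidal.left_unitality_hom (toBase M) ((OneCell.functor x).obj c)
    rw [← MonoidalCategory.tensorHom_id] at h
    exact h
  rightUnit_comp x := by
    ext c
    simp only [comp_nat, NatTrans.comp_app, tensor₂_app, rightUnitAt_app]
    have h := Functor.OplaxMonoidal.right_unitality_hom (toBase M) ((OneCell.functor x).obj c)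
    rw [← MonoidalCategory.id_tensorHom] at h
    exact h
  symm_comp x y := by
    ext c
    simp only [comp_nat, NatTrans.comp_app, symmAt_app]
    exact δ_braiding (toBase M) ((OneCell.functor x).obj c) ((OneCell.functor y).obj c)

end Carrier

/-! ### Rigidity of cartesian structures -/

section Rigidity

open SymmetricMonoidalStructure

variable {C : Type u} [Category.{v} C] [CartesianMonoidalCategory C] [BraidedCategory C]
  {F : C ⥤ C} {L L' : F.LaxBraided}

/-- The component `1 ⟶ 1` of a morphism between cartesian symmetric monoidal structures. -/
def homUnit (f : Hom (productStructure F L) (productStructure F L')) : 𝟙_ C ⟶ 𝟙_ C :=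
  (TwoCell.nat f.unitIso.hom).app Pt.pt

/-- The component `a ⊗ b ⟶ a ⊗ b` of a morphism between cartesian symmetric monoidal
structures. -/
def homMul (f : Hom (productStructure F L) (productStructure F L')) (a b : C) : a ⊗ b ⟶ a ⊗ b :=
  (TwoCell.nat f.mulIso.hom).app (a, b)

theorem homUnit_eq_id (f : Hom (productStructure F L) (productStructure F L')) :
    homUnit f = 𝟙 (𝟙_ C) := toUnit_unique _ _

theorem homMul_naturality (f : Hom (productStructure F L) (productStructure F L')) {a b c d : C}
    (p : a ⟶ b) (q : c ⟶ d) : (p ⊗ₘ q) ≫ homMul f b d = homMul f a c ≫ (p ⊗ₘ q) :=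
  (TwoCell.nat f.mulIso.hom).naturality (X := (a, c)) (Y := (b, d)) (Prod.mkHom p q)

theorem homMul_leftUnitor (f : Hom (productStructure F L) (productStructure F L')) (a : C) :
    homMul f (𝟙_ C) a ≫ (λ_ a).hom = (λ_ a).hom := by
  have h {Z : CartEndo.{v, u}} (x : Z ⟶ of F) (t : Z.C) := nat_app_congr (f.leftUnit_comp x) t
  simp only [comp_nat, NatTrans.comp_app, tensor₂_app, leftUnitAt_app] at h
  have h' : homMul f (𝟙_ C) a ≫ (homUnit f ⊗ₘ 𝟙 a) ≫ (λ_ a).hom = (λ_ a).hom := h (𝟙 (of F)) a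
  simpa [homUnit_eq_id] using h'

theorem homMul_rightUnitor (f : Hom (productStructure F L) (productStructure F L')) (a : C) :
    homMul f a (𝟙_ C) ≫ (ρ_ a).hom = (ρ_ a).hom := by
  have h {Z : CartEndo.{v, u}} (x : Z ⟶ of F) (t : Z.C) := nat_app_congr (f.rightUnit_comp x) t
  simp only [comp_nat, NatTrans.comp_app, tensor₂_app, rightUnitAt_app] at h
  have h' : homMul f a (𝟙_ C) ≫ (𝟙 a ⊗ₘ homUnit f) ≫ (ρ_ a).hom = (ρ_ a).hom := h (𝟙 (of F)) a
  simpa [homUnit_eq_id] using h'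

/-- The first projection is `a ⊗ b ⟶ a ⊗ 1 ≅ a`. Naturality moves the component across to `a ⊗ 1`,
where compatibility with the right unit absorbs it; the second projection is symmetric. -/
theorem homMul_eq_id (f : Hom (productStructure F L) (productStructure F L')) (a b : C) :
    homMul f a b = 𝟙 (a ⊗ b) := by
  apply CartesianMonoidalCategory.hom_ext
  · rw [fst_def, ← id_tensorHom, ← reassoc_of% (homMul_naturality f (𝟙 a)), homMul_rightUnitor,
      Category.id_comp]
  · rw [snd_def, ← tensorHom_id, ← reassoc_of% (homMul_naturality f _ (𝟙 b)), homMul_leftUnitor,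
      Category.id_comp]

/-- The lax symmetric monoidal structure is determined by the isomorphism class of the cartesian
symmetric monoidal structure. -/
theorem eq_of_hom (f : Hom (productStructure F L) (productStructure F L')) : L = L' := by
  have hε : L.ε = L'.ε := by
    have h : homUnit f ≫ L'.ε = L.ε ≫ F.map (homUnit f) := TwoCell.comm f.unitIso.hom Pt.pt
    simpa [homUnit_eq_id] using h.symm
  have hμ (a b : C) : L.μ a b = L'.μ a b := by
    have h : homMul f (F.obj a) (F.obj b) ≫ L'.μ a b = L.μ a b ≫ F.map (homMul f a b) :=
      TwoCell.comm f.mulIso.hom (a, b)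
    simpa [homMul_eq_id] using h.symm
  -- Compatibility with the braiding is a proposition, so equality of the lax monoidal parts
  -- suffices.
  have h : L.toLaxMonoidal = L'.toLaxMonoidal :=
    Functor.LaxMonoidal.ext hε (funext fun a => funext fun b => hμ a b)
  cases L
  cases L'
  cases h
  rfl

instance : Subsingleton (productStructure F L ⟶ productStructure F L') where
  allEq f g := by
    refine Hom.ext (Iso.ext (twoCell_ext fun c => ?_)) (Iso.ext (twoCell_ext fun c => ?_))
    · exact (homMul_eq_id f c.1 c.2).trans (homMul_eq_id g c.1 c.2).symm
    · exact toUnit_unique (C := C) _ _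

end Rigidity

end TwoAlgebra

theorem mainTheorem7 {C : Type u} [Category.{v} C] [CategoryTheory.CartesianMonoidalCategory C]
    [BraidedCategory C] (F : C ⥤ C) :
    (TwoAlgebra.CartEndo.productStructureFunctor F).IsEquivalence where
  faithful := ⟨fun _ => Subsingleton.elim _ _⟩
  -- The mere existence of `f` identifies its two ends, and hom-sets between product structures have
  -- at most one element, so the image of the resulting discrete morphism is `f`.
  full := ⟨fun f => ⟨Discrete.eqToHom (TwoAlgebra.eq_of_hom f), Subsingleton.elim
    (α := TwoAlgebra.CartEndo.productStructure F _ ⟶ TwoAlgebra.CartEndo.productStructure F _) _ _⟩⟩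
  essSurj := ⟨fun M => ⟨⟨TwoAlgebra.Carrier.laxBraided M⟩,
    ⟨(TwoAlgebra.Carrier.comparison M).toIso.symm⟩⟩⟩
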